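/- A coloring $c$ of the vertices of a graph $G$ is nonrepetitive if there are no $l\ge 1$ and no path $v_1v_2\ldots v_{2l}$ in $G$ (with pairwise distinct vertices) such that $c(v_i)=c(v_{l+i})$ for all $1\le i\le l$. Let $\pi(G)$, the Thue chromatic number of $G$, be the least number of colors in a nonrepetitive coloring of $G$. For graphs $G=(V_1,E_1)$ and $H=(V_2,E_2)$ the lexicographic product $G[H]$ is the graph with vertex set $V_1\times V_2$ in which $(v_1,v_2)$ and $(v_1',v_2')$ are adjacent if and only if either $v_1v_1'\in E_1$, or $v_1=v_1'$ and $v_2v_2'\in E_2$. Let $P_n$ be the path on $n$ vertices and $K_k$ the complete graph on $k$ vertices. Theorem. For all integers $n\ge 28$ and $k\ge 1$, $$3k+\lfloor k/2\rfloor\le \pi(P_n[K_k])\le 4k.$$ -/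

import Mathlib

namespace ThueLex

/-- The lexicographic product `G[H]`: the vertices `(a, x)` and `(b, y)` are adjacent when `a` and
`b` are adjacent in `G`, or when `a = b` and `x`, `y` are adjacent in `H`. -/
def lexProduct {V W : Type*} (G : SimpleGraph V) (H : SimpleGraph W) : SimpleGraph (V × W) where
  Adj p q := G.Adj p.1 q.1 ∨ (p.1 = q.1 ∧ H.Adj p.2 q.2)
  symm := ⟨by
    rintro p q (h | ⟨h, h'⟩)
    · exact Or.inl h.symm
    · exact Or.inr ⟨h.symm, h'.symm⟩⟩
  loopless := ⟨by
    rintro p (h | ⟨_, h⟩)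
    · exact G.irrefl h
    · exact H.irrefl h⟩

/-- A finite sequence is a repetition if it consists of two consecutive copies of the same
nonempty sequence. -/
def IsRepetition {C : Type*} (s : List C) : Prop :=
  ∃ x : List C, x ≠ [] ∧ s = x ++ x

/-- A vertex coloring is nonrepetitive if the sequence of colors along a path (with pairwise
distinct vertices) is never a repetition. -/
def IsNonrepetitive {V C : Type*} (G : SimpleGraph V) (c : V → C) : Prop :=
  ∀ (u v : V) (p : G.Walk u v), p.IsPath → ¬ IsRepetition (p.support.map c)

/-- The Thue chromatic number `π(G)`: the least number of colors of a nonrepetitive coloring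
(`⊤` when no finite number of colors suffices). -/
noncomputable def thueNumber {V : Type*} (G : SimpleGraph V) : ℕ∞ :=
  ⨅ m ∈ {m : ℕ | ∃ c : V → Fin m, IsNonrepetitive G c}, (m : ℕ∞)

end ThueLex

/-!
The copies of `K_k` in `P_n[K_k]` are called blocks. Distinct vertices are adjacent exactly when
their blocks are equal or consecutive, so a path is a lazy walk along the blocks that never takes the
same vertex twice.

**Upper bound.** Give the `t`-th vertex of the block `i` the color `(w i, t)`, where `w` is a word over
four letters that has no squares and in which letters at distance two differ. Such a word arises from
the square-free ternary word of differences of the Thue–Morse word by writing a fourth letter before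
every second letter (`quaternaryWord`). If the letters along a lazy walk form a repetition, then the
second half of the walk is a translate or a mirror image of the first, and some step of the first half
is in the same block as the corresponding step of the second
(`exists_eq_of_repetitive_lazy_walk`); in a repetition of colors along a path these two vertices would
be equal.

**Lower bound.** Let `A i` be the set of the `k` colors of the block `i`, and suppose that there are at
most `4 * k - r` colors, where `2 * r ≥ k + 2` (`Config`). Two principles carry the proof. First, two
blocks that avoid each of two disjoint blocks share at least `r` colors, more than half of their colors
(`Config.big_of_disjoint`), and such strong coincidences can be composed once
(`Config.exists_mem_ne_of_big`). Second, a list of triples `(i, j, x)` with `x ∈ A i ∩ A j` yields a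
repetition as soon as consecutive entries are close to each other and the last `i` is close to the
first `j` (`Config.false_of_triples`). With these, short repetitions show that strong coincidences at
distance two (`Big r A i (i + 2)`), which exist, cannot follow each other after two or after three blocks
(`Config.false_of_big_of_big_two`, `Config.false_of_big_of_big_three`). So they occur exactly at every
fourth block (`Config.pair_of_big`), and the color sets look like the word `acabcacb` of period eight.
Counting shows that blocks at distance eight still have common colors, up to a harmless exception
(`Config.period_eight`), and so sixteen consecutive blocks contain a repetition
(`Config.false_of_pairs`). Twenty-three blocks suffice for all this.
-/

namespace ThueLex

/-! ### A square-free word over four letters without palindromes of length three -/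

/-- The Thue–Morse word: `thueMorse n` is the parity of the number of ones among the binary digits
of `n`. -/
def thueMorse (n : ℕ) : Bool :=
  if h : n = 0 then false else xor (n % 2 == 1) (thueMorse (n / 2))
termination_by n
decreasing_by omega

theorem thueMorse_two_mul (n : ℕ) : thueMorse (2 * n) = thueMorse n := by
  rcases Nat.eq_zero_or_pos n with rfl | h
  · rfl
  · rw [thueMorse, dif_neg (by omega)]
    simp

theorem thueMorse_two_mul_add_one (n : ℕ) : thueMorse (2 * n + 1) = !thueMorse n := by
  rw [thueMorse, dif_neg (by omega), show (2 * n + 1) / 2 = n by omega,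
    show (2 * n + 1) % 2 = 1 by omega]
  simp

theorem thueMorse_ne_succ_of_even {n : ℕ} (h : n % 2 = 0) :
    thueMorse n ≠ thueMorse (n + 1) := by
  obtain ⟨m, rfl⟩ : ∃ m, n = 2 * m := ⟨n / 2, by omega⟩
  rw [thueMorse_two_mul, thueMorse_two_mul_add_one]
  simp

/-- The Thue–Morse word has no overlap: no factor of length `2 * p + 1` has period `p`. For even
`p` one halves the period. For odd `p`, one of the positions `i + j` and `i + j + p` is even, which
forces the letters to alternate along a whole period, and this is absurd for an odd period. -/
theorem thueMorse_overlap_free (p : ℕ) (hp : 0 < p) (i : ℕ) :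
    ¬ ∀ j ≤ p, thueMorse (i + j) = thueMorse (i + j + p) := by
  induction p using Nat.strong_induction_on generalizing i with
  | _ p ih =>
  intro h
  rcases Nat.mod_two_eq_zero_or_one p with hpar | hpar
  · obtain ⟨q, rfl⟩ : ∃ q, p = 2 * q := ⟨p / 2, by omega⟩
    refine ih q (by omega) (by omega) (i / 2) fun j hj => ?_
    have key := h (2 * j) (by omega)
    rcases Nat.mod_two_eq_zero_or_one i with hi | hi
    · rw [show i + 2 * j + 2 * q = 2 * (i / 2 + j + q) by omega,
        show i + 2 * j = 2 * (i / 2 + j) by omega, thueMorse_two_mul, thueMorse_two_mul] at key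
      exact key
    · rw [show i + 2 * j + 2 * q = 2 * (i / 2 + j + q) + 1 by omega,
        show i + 2 * j = 2 * (i / 2 + j) + 1 by omega, thueMorse_two_mul_add_one,
        thueMorse_two_mul_add_one] at key
      simpa using key
  · have alt : ∀ j < p, thueMorse (i + j) ≠ thueMorse (i + j + 1) := by
      intro j hj
      rcases Nat.mod_two_eq_zero_or_one (i + j) with hj' | hj'
      · exact thueMorse_ne_succ_of_even hj'
      · have h0 := thueMorse_ne_succ_of_even (n := i + j + p) (by omega)
        have h1 := h (j + 1) (by omega)
        rw [h j hj.le, show i + j + 1 = i + (j + 1) from rfl, h1,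
          show i + (j + 1) + p = i + j + p + 1 by omega]
        exact h0
    have par : ∀ j ≤ p, thueMorse (i + j) = xor (j % 2 == 1) (thueMorse i) := by
      intro j
      induction j with
      | zero => simp
      | succ j ihj =>
        intro hj
        have h1 := alt j (by omega)
        rw [ihj (by omega)] at h1
        rw [← add_assoc]
        rcases Nat.mod_two_eq_zero_or_one j with h2 | h2
        · have h3 : (j + 1) % 2 = 1 := by omega
          rw [h2] at h1
          rw [h3]
          revert h1
          cases thueMorse i <;> cases thueMorse (i + j + 1) <;> simp
        · have h3 : (j + 1) % 2 = 0 := by omega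
          rw [h2] at h1
          rw [h3]
          revert h1
          cases thueMorse i <;> cases thueMorse (i + j + 1) <;> simp
    have h0 := h 0 (by omega)
    have h1 := par p le_rfl
    rw [add_zero, h1, hpar] at h0
    revert h0
    cases thueMorse i <;> simp

/-- The differences `0`, `1`, `-1` of consecutive letters of the Thue–Morse word, written with the
letters `0`, `1`, `2`. -/
def ternaryWord (n : ℕ) : Fin 4 :=
  if thueMorse n = thueMorse (n + 1) then 0 else if thueMorse (n + 1) then 1 else 2

theorem ternaryWord_ne_three (n : ℕ) : ternaryWord n ≠ 3 := by
  unfold ternaryWord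
  split_ifs <;> decide

theorem ternaryWord_eq_iff (a b : ℕ) : ternaryWord a = ternaryWord b ↔
    ((thueMorse (a + 1)).toNat : ℤ) - (thueMorse a).toNat =
      (thueMorse (b + 1)).toNat - (thueMorse b).toNat := by
  unfold ternaryWord
  cases thueMorse a <;> cases thueMorse (a + 1) <;> cases thueMorse b <;>
    cases thueMorse (b + 1) <;> simp

theorem ternaryWord_square_free (p : ℕ) (hp : 0 < p) (i : ℕ) :
    ¬ ∀ j < p, ternaryWord (i + j) = ternaryWord (i + j + p) := by
  intro h
  have key : ∀ j ≤ p, ((thueMorse (i + j)).toNat : ℤ) - (thueMorse i).toNat =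
      (thueMorse (i + j + p)).toNat - (thueMorse (i + p)).toNat := by
    intro j
    induction j with
    | zero => simp
    | succ j ih =>
      intro hj
      have h1 := (ternaryWord_eq_iff _ _).1 (h j hj)
      have h2 := ih (by omega)
      rw [← add_assoc i j 1, show i + j + 1 + p = i + j + p + 1 by omega]
      omega
  have bound : ∀ b : Bool, b.toNat ≤ 1 := by decide
  -- A difference that occurs twice in a row between values in `{0, 1}` vanishes.
  have h0 : ((thueMorse i).toNat : ℤ) = (thueMorse (i + p)).toNat := by
    have h1 := key p le_rfl
    have h2 := bound (thueMorse i)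
    have h3 := bound (thueMorse (i + p))
    have h4 := bound (thueMorse (i + p + p))
    omega
  refine thueMorse_overlap_free p hp i fun j hj => ?_
  have h1 := key j hj
  have h2 : (thueMorse (i + j)).toNat = (thueMorse (i + j + p)).toNat := by omega
  revert h2
  cases thueMorse (i + j) <;> cases thueMorse (i + j + p) <;> simp

/-- The letters of `ternaryWord` with an additional letter `3` in front of every second one. -/
def quaternaryWord (n : ℕ) : Fin 4 :=
  if n % 3 = 0 then 3 else ternaryWord (2 * (n / 3) + n % 3 - 1)

theorem quaternaryWord_eq_three_iff (n : ℕ) : quaternaryWord n = 3 ↔ n % 3 = 0 := by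
  unfold quaternaryWord
  split_ifs with h
  · simp [h]
  · simp [h, ternaryWord_ne_three]

theorem quaternaryWord_of_mod_ne {n m : ℕ} (h : n % 3 ≠ 0) (hm : m = 2 * (n / 3) + n % 3 - 1) :
    quaternaryWord n = ternaryWord m := by
  rw [quaternaryWord, if_neg h, hm]

theorem ternaryWord_ne_succ (n : ℕ) : ternaryWord n ≠ ternaryWord (n + 1) := fun h =>
  ternaryWord_square_free 1 one_pos n fun j hj => by
    obtain rfl : j = 0 := by omega
    exact h

theorem quaternaryWord_ne_succ (n : ℕ) : quaternaryWord n ≠ quaternaryWord (n + 1) := by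
  intro h
  have h3 := quaternaryWord_eq_three_iff n
  rw [h, quaternaryWord_eq_three_iff] at h3
  rw [quaternaryWord_of_mod_ne (m := 2 * (n / 3)) (by omega) (by omega),
    quaternaryWord_of_mod_ne (m := 2 * (n / 3) + 1) (by omega) (by omega)] at h
  exact ternaryWord_ne_succ _ h

theorem quaternaryWord_ne_add_two (n : ℕ) : quaternaryWord n ≠ quaternaryWord (n + 2) := by
  intro h
  have h3 := quaternaryWord_eq_three_iff n
  rw [h, quaternaryWord_eq_three_iff] at h3
  rw [quaternaryWord_of_mod_ne (m := 2 * (n / 3) + 1) (by omega) (by omega),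
    quaternaryWord_of_mod_ne (m := 2 * (n / 3) + 1 + 1) (by omega) (by omega)] at h
  exact ternaryWord_ne_succ _ h

theorem quaternaryWord_square_free (p : ℕ) (hp : 0 < p) (i : ℕ) :
    ¬ ∀ j < p, quaternaryWord (i + j) = quaternaryWord (i + j + p) := by
  intro h
  have p1 : p ≠ 1 := by
    rintro rfl
    exact quaternaryWord_ne_succ i (h 0 (by omega))
  have p2 : p ≠ 2 := by
    rintro rfl
    exact quaternaryWord_ne_add_two i (h 0 (by omega))
  -- The position of a letter `3` in the first half shows that the period is divisible by three.
  have p3 : p % 3 = 0 := by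
    have h1 := h ((3 - i % 3) % 3) (by omega)
    have h2 := quaternaryWord_eq_three_iff (i + (3 - i % 3) % 3)
    rw [h1, quaternaryWord_eq_three_iff] at h2
    omega
  -- Deleting the letters `3` leaves a square in the ternary word.
  let s := 2 * (i / 3) + if i % 3 = 2 then 1 else 0
  have hs : s = 2 * (i / 3) + if i % 3 = 2 then 1 else 0 := rfl
  refine ternaryWord_square_free (2 * (p / 3)) (by omega) s fun j hj => ?_
  have hlo : i ≤ 3 * ((s + j) / 2) + 1 + (s + j) % 2 := by split_ifs at hs <;> omega
  have hhi : 3 * ((s + j) / 2) + 1 + (s + j) % 2 < i + p := by split_ifs at hs <;> omega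
  have key := h (3 * ((s + j) / 2) + 1 + (s + j) % 2 - i) (by omega)
  rw [quaternaryWord_of_mod_ne (m := s + j) (by omega) (by omega),
    quaternaryWord_of_mod_ne (m := s + j + 2 * (p / 3)) (by omega) (by omega)] at key
  exact key


/-! ### Lazy walks on a path colored by the word -/

theorem exists_step_of_not {P : ℕ → Prop} {l : ℕ} (h0 : P 0) (hl : ¬ P l) :
    ∃ j < l, P j ∧ ¬ P (j + 1) := by
  induction l with
  | zero => exact absurd h0 hl
  | succ l ih =>
    by_cases h : P l
    · exact ⟨l, l.lt_succ_self, h, hl⟩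
    · obtain ⟨j, hj, h'⟩ := ih h
      exact ⟨j, by omega, h'⟩

theorem exists_eq_of_le_of_lt {v : ℕ → ℤ} {l : ℕ} (hstep : ∀ i < l, |v (i + 1) - v i| ≤ 1)
    {x : ℤ} (h0 : v 0 ≤ x) (hl : x < v l) : ∃ j < l, v j = x := by
  obtain ⟨j, hj, h1, h2⟩ := exists_step_of_not (P := fun j => v j ≤ x) h0 (by simpa using hl)
  have := abs_le.1 (hstep j hj)
  exact ⟨j, hj, by simp only [not_le] at h2; omega⟩

/-- Let `w` be a word without squares in which letters at distance one or two differ. If the letters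
read along a lazy walk `v 0, …, v (2 * l - 1)` on the nonnegative integers form a repetition, then
some step of the first half is at the same position as the corresponding step of the second half.

As letters at distance two differ, the direction of each step of the second half is determined by
the letters, once one step in each half is known. So the second half is the image of the first under
a translation or a reflection. A nontrivial translation would give a square in `w`, and a reflection
takes the value `v i` to itself for some `i`, as the walk gets from `v 0` to its mirror image `v l`. -/
theorem exists_eq_of_repetitive_lazy_walk {α : Type*} {w : ℕ → α}
    (hw1 : ∀ n, w n ≠ w (n + 1)) (hw2 : ∀ n, w n ≠ w (n + 2))
    (hsq : ∀ p > 0, ∀ i, ¬ ∀ j < p, w (i + j) = w (i + j + p))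
    {v : ℕ → ℤ} {l : ℕ} (hl : 0 < l) (hv : ∀ i < 2 * l, 0 ≤ v i)
    (hstep : ∀ i, i + 1 < 2 * l → |v (i + 1) - v i| ≤ 1)
    (hrep : ∀ i < l, w (v i).toNat = w (v (l + i)).toNat) :
    ∃ i < l, v i = v (l + i) := by
  -- The word as a function on the integers, used at nonnegative arguments only.
  obtain ⟨W, hW⟩ : ∃ W : ℤ → α, ∀ x, W x = w x.toNat := ⟨_, fun _ => rfl⟩
  have hrep' : ∀ i < l, W (v i) = W (v (l + i)) := fun i hi => by rw [hW, hW, hrep i hi]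
  have hsq' : ∀ E > 0, ∀ y ≥ 0, ¬ ∀ x, y ≤ x → x < y + E → W x = W (x + E) := by
    intro E hE y hy h
    refine hsq E.toNat (by omega) y.toNat fun j hj => ?_
    have := h (y + j) (by omega) (by omega)
    rw [hW, hW] at this
    rwa [show (y + j).toNat = y.toNat + j by omega,
      show (y + j + E).toNat = y.toNat + j + E.toNat by omega] at this
  have near1 : ∀ x y : ℤ, 0 ≤ x → 0 ≤ y → |y - x| ≤ 1 → W x = W y → x = y := by
    intro x y hx hy hd h
    rw [abs_le] at hd
    rw [hW, hW] at h
    by_contra hne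
    rcases lt_or_gt_of_ne hne with h' | h'
    · refine hw1 x.toNat ?_
      rwa [show x.toNat + 1 = y.toNat by omega]
    · refine hw1 y.toNat ?_
      rw [show y.toNat + 1 = x.toNat by omega]
      exact h.symm
  have near2 : ∀ x y : ℤ, 0 ≤ x → 0 ≤ y → |y - x| = 2 → W x ≠ W y := by
    intro x y hx hy hd h
    rw [hW, hW] at h
    rcases (abs_eq (by norm_num)).1 hd with h' | h'
    · refine hw2 x.toNat ?_
      rwa [show x.toNat + 2 = y.toNat by omega]
    · refine hw2 y.toNat ?_
      rw [show y.toNat + 2 = x.toNat by omega]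
      exact h.symm
  -- Either both halves have been constant so far, or the second is an isometric image of the first.
  have inv : ∀ i < l, (∀ j ≤ i, v j = v 0 ∧ v (l + j) = v l) ∨
      ∃ ε : ℤ, (ε = 1 ∨ ε = -1) ∧ (∀ j ≤ i, v (l + j) = v l + ε * (v j - v 0)) ∧
        ∃ j ≤ i, |v j - v i| = 1 := by
    intro i
    induction i with
    | zero =>
      intro _
      left
      intro j hj
      obtain rfl : j = 0 := by omega
      simp
    | succ i ih =>
      intro hi
      have s1 := hstep i (by omega)
      have s2 := hstep (l + i) (by omega)
      rw [add_assoc] at s2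
      have p1 := hv i (by omega)
      have p2 := hv (i + 1) (by omega)
      have p3 := hv (l + i) (by omega)
      have p4 := hv (l + (i + 1)) (by omega)
      have c1 := hrep' i (by omega)
      have c2 := hrep' (i + 1) hi
      have same : v (i + 1) = v i ↔ v (l + (i + 1)) = v (l + i) := by
        constructor
        · intro h
          exact (near1 _ _ p3 p4 s2 (by rw [← c1, ← c2, h])).symm
        · intro h
          exact (near1 _ _ p1 p2 s1 (by rw [c1, c2, h])).symm
      rw [abs_le] at s1 s2
      rcases ih (by omega) with hc | ⟨ε, hε, hφ, z, hz, hzi⟩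
      · obtain ⟨hc1, hc2⟩ := hc i le_rfl
        by_cases hs : v (i + 1) = v i
        · left
          intro j hj
          rcases Nat.lt_or_ge j (i + 1) with hj' | hj'
          · exact hc j (by omega)
          · obtain rfl : j = i + 1 := by omega
            rw [same.1 hs, hs]
            exact ⟨hc1, hc2⟩
        · have hs' := mt same.2 hs
          right
          have key : ∃ ε : ℤ, (ε = 1 ∨ ε = -1) ∧
              v (l + (i + 1)) = v l + ε * (v (i + 1) - v 0) := by
            by_cases h : v (l + (i + 1)) - v l = v (i + 1) - v 0
            · exact ⟨1, Or.inl rfl, by omega⟩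
            · exact ⟨-1, Or.inr rfl, by omega⟩
          obtain ⟨ε, hε, he⟩ := key
          refine ⟨ε, hε, fun j hj => ?_, i, by omega, ?_⟩
          · rcases Nat.lt_or_ge j (i + 1) with hj' | hj'
            · obtain ⟨h1, h2⟩ := hc j (by omega)
              rw [h1, h2]
              ring
            · obtain rfl : j = i + 1 := by omega
              exact he
          · rw [abs_eq (by norm_num)]
            omega
      · right
        have hφi := hφ i le_rfl
        have hφz := hφ z hz
        have cz := hrep' z (by omega)
        have pz := hv z (by omega)
        have pz' := hv (l + z) (by omega)
        rw [abs_eq (by norm_num)] at hzi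
        have he : v (l + (i + 1)) = v l + ε * (v (i + 1) - v 0) := by
          by_cases hs : v (i + 1) = v i
          · rw [same.1 hs, hs, hφi]
          have hs' := mt same.2 hs
          by_cases hxz : v (i + 1) = v z
          · have : ¬ |v (l + z) - v (l + (i + 1))| = 2 := fun h =>
              near2 _ _ p4 pz' h (by rw [← c2, ← cz, hxz])
            rw [abs_eq (by norm_num)] at this
            rw [hxz, ← hφz]
            rcases hε with rfl | rfl <;> omega
          · have h2 : W (v (i + 1)) ≠ W (v z) := by
              refine near2 _ _ p2 pz ?_
              rw [abs_eq (by norm_num)]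
              omega
            have h3 : v (l + (i + 1)) ≠ v (l + z) := fun h => h2 (by rw [c2, cz, h])
            rcases hε with rfl | rfl <;> omega
        refine ⟨ε, hε, fun j hj => ?_, ?_⟩
        · rcases Nat.lt_or_ge j (i + 1) with hj' | hj'
          · exact hφ j (by omega)
          · obtain rfl : j = i + 1 := by omega
            exact he
        · by_cases hs : v (i + 1) = v i
          · exact ⟨z, by omega, by rw [hs, abs_eq (by norm_num)]; exact hzi⟩
          · refine ⟨i, by omega, ?_⟩
            rw [abs_eq (by norm_num)]
            omega
  have hstep' : ∀ i < l, |v (i + 1) - v i| ≤ 1 := fun i hi => hstep i (by omega)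
  have last := hstep (l - 1) (by omega)
  rw [show l - 1 + 1 = l by omega] at last
  have pl := hv l (by omega)
  have p0 := hv 0 (by omega)
  rcases inv (l - 1) (by omega) with hc | ⟨ε, rfl | rfl, hφ, -⟩
  · obtain ⟨h1, h2⟩ := hc (l - 1) le_rfl
    have h3 := hrep' (l - 1) (by omega)
    refine ⟨l - 1, by omega, ?_⟩
    rw [h2] at h3 ⊢
    exact near1 _ _ (hv _ (by omega)) pl last h3
  · -- A translation by `v l - v 0`.
    rcases lt_trichotomy (v 0) (v l) with h | h | h
    · exfalso
      refine hsq' (v l - v 0) (by omega) (v 0) p0 fun x hx1 hx2 => ?_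
      obtain ⟨j, hj, rfl⟩ := exists_eq_of_le_of_lt hstep' hx1 (by omega)
      rw [hrep' j hj, hφ j (by omega)]
      congr 1
      ring
    · exact ⟨0, hl, h⟩
    · exfalso
      have visit : ∀ x, v l < x → x ≤ v 0 → ∃ j < l, v j = x := by
        intro x h1 h2
        obtain ⟨j, hj, hj'⟩ := exists_eq_of_le_of_lt (v := fun i => - v i) (l := l) (x := -x)
          (fun i hi => by
            have := hstep' i hi
            rw [abs_le] at this ⊢
            constructor <;> omega) (by omega) (by omega)
        exact ⟨j, hj, by omega⟩
      have back : ∀ x, v l < x → x ≤ v 0 → 0 ≤ x + (v l - v 0) ∧ W x = W (x + (v l - v 0)) := by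
        intro x h1 h2
        obtain ⟨j, hj, rfl⟩ := visit x h1 h2
        have e : v j + (v l - v 0) = v (l + j) := by rw [hφ j (by omega)]; ring
        rw [e]
        exact ⟨hv _ (by omega), hrep' j hj⟩
      refine hsq' (v 0 - v l) (by omega) (2 * v l - v 0 + 1) ?_ fun x hx1 hx2 => ?_
      · have := (back (v l + 1) (by omega) (by omega)).1
        omega
      · have := (back (x + (v 0 - v l)) (by omega) (by omega)).2
        rw [this]
        congr 1
        ring
  · -- A reflection that exchanges `v 0` and `v l`.
    have hmid : ∀ j < l, (2 * v j < v 0 + v l ∧ ¬ 2 * v (j + 1) < v 0 + v l) ∨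
        (2 * v j > v 0 + v l ∧ ¬ 2 * v (j + 1) > v 0 + v l) → 2 * v (j + 1) = v 0 + v l := by
      intro j hj h
      by_contra hne
      have h1 := abs_le.1 (hstep' j hj)
      have h2 := hφ j (by omega)
      have h3 := near1 (v j) (v (l + j)) (hv _ (by omega)) (hv _ (by omega))
        (by rw [abs_le]; omega) (hrep' j hj)
      omega
    have fin : ∀ j < l, 2 * v (j + 1) = v 0 + v l → ∃ i < l, v i = v (l + i) := by
      intro j hj h
      rcases Nat.lt_or_ge (j + 1) l with hj' | hj'
      · have := hφ (j + 1) (by omega)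
        exact ⟨j + 1, hj', by omega⟩
      · obtain rfl : l = j + 1 := by omega
        exact ⟨0, hl, by rw [add_zero]; omega⟩
    rcases lt_trichotomy (v 0) (v l) with h | h | h
    · obtain ⟨j, hj, h1, h2⟩ := exists_step_of_not (P := fun j => 2 * v j < v 0 + v l)
        (l := l) (by omega) (by omega)
      exact fin j hj (hmid j hj (Or.inl ⟨h1, h2⟩))
    · exact ⟨0, hl, h⟩
    · obtain ⟨j, hj, h1, h2⟩ := exists_step_of_not (P := fun j => 2 * v j > v 0 + v l)
        (l := l) (by omega) (by omega)
      exact fin j hj (hmid j hj (Or.inr ⟨h1, h2⟩))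

/-! ### The upper bound -/

/-- The vertex `(i, t)` gets the color `(w i, t)`, where `w` is the word over four letters. In a
repetition of colors along a path, the two corresponding vertices in the same copy of the second
factor would coincide. -/
theorem isNonrepetitive_quaternaryWord (n k : ℕ) :
    IsNonrepetitive (lexProduct (SimpleGraph.pathGraph n) (⊤ : SimpleGraph (Fin k)))
      fun q => finProdFinEquiv (quaternaryWord q.1, q.2) := by
  rintro u u' p hp ⟨x, hx, h⟩
  have hnodup := hp.support_nodup
  have hchain := p.isChain_adj_support
  generalize p.support = L at h hnodup hchain
  have hlen : L.length = 2 * x.length := by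
    have := congrArg List.length h
    simp only [List.length_map, List.length_append] at this
    omega
  have hpos : 0 < x.length := List.length_pos_iff.2 hx
  have hcol : ∀ i (hi : i < x.length),
      (quaternaryWord (L[i]'(by omega)).1, (L[i]'(by omega)).2) =
        (quaternaryWord (L[x.length + i]'(by omega)).1, (L[x.length + i]'(by omega)).2) := by
    intro i hi
    apply finProdFinEquiv.injective
    have e1 : (L.map fun q => finProdFinEquiv (quaternaryWord q.1, q.2))[i]'(by simp; omega) =
        x[i] := by
      simp only [h]
      exact List.getElem_append_left hi
    have e2 : (L.map fun q => finProdFinEquiv (quaternaryWord q.1, q.2))[x.length + i]'(by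
        simp; omega) = x[i] := by
      simp only [h]
      rw [List.getElem_append_right (by omega)]
      simp
    rw [List.getElem_map] at e1 e2
    rw [e1, e2]
  obtain ⟨v, hv⟩ : ∃ v : ℕ → ℤ, ∀ i (hi : i < L.length), v i = ((L[i].1 : ℕ) : ℤ) :=
    ⟨fun i => if hi : i < L.length then ((L[i].1 : ℕ) : ℤ) else 0, fun i hi => dif_pos hi⟩
  obtain ⟨i, hi, he⟩ := exists_eq_of_repetitive_lazy_walk quaternaryWord_ne_succ
    quaternaryWord_ne_add_two quaternaryWord_square_free (v := v) hpos
    (fun i hi => by rw [hv i (by omega)]; omega)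
    (fun i hi => by
      rw [hv i (by omega), hv (i + 1) (by omega), abs_le]
      rcases List.isChain_iff_getElem.1 hchain i (by omega) with h' | ⟨h', -⟩
      · rw [SimpleGraph.pathGraph_adj] at h'
        omega
      · rw [h']
        simp)
    (fun i hi => by
      rw [hv i (by omega), hv (x.length + i) (by omega)]
      exact congrArg Prod.fst (hcol i hi))
  rw [hv i (by omega), hv (x.length + i) (by omega)] at he
  have : L[i] = L[x.length + i] :=
    Prod.ext (Fin.ext (by exact_mod_cast he)) (Prod.mk.inj (hcol i hi)).2
  have := (hnodup.getElem_inj_iff).1 this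
  omega


/-! ### Color sets of the blocks -/

/-- The combinatorial data carried by a nonrepetitive coloring of `P_N[K_k]` with few colors: `A i`
is the set of the `k` colors used on the `i`-th copy of `K_k`, the number `r` measures how far the
number of colors falls short of `4 * k`, and `2 * r ≥ k + 2` says that it is less than
`3 * k + k / 2`. A vertex is given as a pair `(i, x)` with `x ∈ A i`, and distinct vertices are
adjacent when their blocks are equal or consecutive. -/
structure Config {C : Type*} [Fintype C] (k r N : ℕ) (A : ℕ → Finset C) : Prop where
  card_eq : ∀ i < N, (A i).card = k
  card_add_le : Fintype.card C + r ≤ 4 * k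
  le_two_mul : k + 2 ≤ 2 * r
  not_repetition : ∀ l₁ l₂ : List (ℕ × C), l₁ ≠ [] → l₁.map Prod.snd = l₂.map Prod.snd →
    (∀ v ∈ l₁ ++ l₂, v.1 < N ∧ v.2 ∈ A v.1) → (l₁ ++ l₂).Nodup →
    (l₁ ++ l₂).IsChain (fun v w => v.1 ≤ w.1 + 1 ∧ w.1 ≤ v.1 + 1) → False

/-- The color sets of the blocks `i` and `j` share at least `r`, so more than half of their colors.
Below this is called a strong coincidence, and a single common color a coincidence. -/
def Big {C : Type*} [DecidableEq C] (r : ℕ) (A : ℕ → Finset C) (i j : ℕ) : Prop :=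
  r ≤ (A i ∩ A j).card

theorem Big.symm {C : Type*} [DecidableEq C] {r : ℕ} {A : ℕ → Finset C} {i j : ℕ}
    (h : Big r A i j) : Big r A j i := by
  rwa [Big, Finset.inter_comm]

theorem ne_of_disjoint {C : Type*} {s t : Finset C} (h : Disjoint s t) {x y : C} (hx : x ∈ s)
    (hy : y ∈ t) : x ≠ y := by
  rintro rfl
  exact Finset.disjoint_left.1 h hx hy

section
variable {C : Type*} [Fintype C] {k r N : ℕ} {A : ℕ → Finset C}

namespace Config

theorem mono (h : Config k r N A) {M : ℕ} (hM : M ≤ N) : Config k r M A where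
  card_eq i hi := h.card_eq i (by omega)
  card_add_le := h.card_add_le
  le_two_mul := h.le_two_mul
  not_repetition l₁ l₂ h0 h1 h2 h3 h4 :=
    h.not_repetition l₁ l₂ h0 h1 (fun v hv => ⟨by have := (h2 v hv).1; omega, (h2 v hv).2⟩) h3 h4

/-- Blocks may be renumbered by a translation or a reflection. -/
theorem comap (h : Config k r N A) {M : ℕ} (f : ℕ → ℕ) (hf : ∀ i < M, f i < N)
    (hinj : ∀ i < M, ∀ j < M, f i = f j → i = j)
    (hadj : ∀ i < M, ∀ j < M, i ≤ j + 1 → j ≤ i + 1 → f i ≤ f j + 1 ∧ f j ≤ f i + 1) :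
    Config k r M (fun i => A (f i)) where
  card_eq i hi := h.card_eq _ (hf i hi)
  card_add_le := h.card_add_le
  le_two_mul := h.le_two_mul
  not_repetition l₁ l₂ h0 h1 h2 h3 h4 := by
    refine h.not_repetition (l₁.map (Prod.map f id)) (l₂.map (Prod.map f id)) (by simpa using h0)
      ?_ ?_ ?_ ?_
    · simpa [Function.comp_def] using h1
    · rw [← List.map_append]
      intro v hv
      obtain ⟨w, hw, rfl⟩ := List.mem_map.1 hv
      exact ⟨hf _ (h2 w hw).1, (h2 w hw).2⟩
    · rw [← List.map_append]
      refine List.Nodup.map_on ?_ h3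
      rintro ⟨i, x⟩ hi ⟨j, y⟩ hj he
      simp only [Prod.map_apply, id_eq, Prod.mk.injEq] at he ⊢
      exact ⟨hinj _ (h2 _ hi).1 _ (h2 _ hj).1 he.1, he.2⟩
    · rw [← List.map_append, List.isChain_iff_getElem]
      intro i hi
      simp only [List.length_map] at hi
      simp only [List.getElem_map, Prod.map_fst]
      have := List.isChain_iff_getElem.1 h4 i hi
      exact hadj _ (h2 _ (List.getElem_mem _)).1 _ (h2 _ (List.getElem_mem _)).1 this.1 this.2

theorem shift (h : Config k r N A) (s : ℕ) {M : ℕ} (hM : s + M ≤ N) :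
    Config k r M (fun i => A (s + i)) :=
  h.comap (fun i => s + i) (by omega) (by omega) (by omega)

theorem reflect (h : Config k r N A) : Config k r N (fun i => A (N - 1 - i)) :=
  h.comap (fun i => N - 1 - i) (by omega) (by omega) (by omega)

/-- There is no repetition in the following form: a triple `(i, j, x)` stands for the two vertices of
color `x` in the blocks `i` and `j`; the path runs through the first vertices of all triples of the
list, and then through the second ones. -/
theorem false_of_triples (h : Config k r N A) (T : List (ℕ × ℕ × C)) (h0 : T ≠ [])
    (hT : ∀ t ∈ T, t.1 < N ∧ t.2.1 < N ∧ t.2.2 ∈ A t.1 ∧ t.2.2 ∈ A t.2.1)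
    (hnodup : (T.map (fun t => (t.1, t.2.2)) ++ T.map (fun t => (t.2.1, t.2.2))).Nodup)
    (hchain : (T.map (fun t => t.1) ++ T.map (fun t => t.2.1)).IsChain
      (fun i j => i ≤ j + 1 ∧ j ≤ i + 1)) : False := by
  refine h.not_repetition (T.map fun t => (t.1, t.2.2)) (T.map fun t => (t.2.1, t.2.2))
    (by simpa using h0) (by simp [Function.comp_def]) ?_ hnodup ?_
  · intro v hv
    rcases List.mem_append.1 hv with hv | hv <;> obtain ⟨t, ht, rfl⟩ := List.mem_map.1 hv
    · exact ⟨(hT t ht).1, (hT t ht).2.2.1⟩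
    · exact ⟨(hT t ht).2.1, (hT t ht).2.2.2⟩
  · have : T.map (fun t => t.1) ++ T.map (fun t => t.2.1) =
        (T.map (fun t => (t.1, t.2.2)) ++ T.map (fun t => (t.2.1, t.2.2))).map Prod.fst := by
      simp [Function.comp_def]
    rwa [this, List.isChain_map] at hchain

theorem disjoint_succ (h : Config k r N A) (i : ℕ) (hi : i + 1 < N := by omega) :
    Disjoint (A i) (A (i + 1)) := by
  rw [Finset.disjoint_left]
  intro x hx hy
  exact h.false_of_triples [(i, i + 1, x)] (by simp)
    (by simp [hx, hy, hi, Nat.lt_of_succ_lt hi]) (by simp) (by simp; omega)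

theorem succ_disjoint (h : Config k r N A) (i : ℕ) (hi : i + 1 < N := by omega) :
    Disjoint (A (i + 1)) (A i) :=
  (h.disjoint_succ i hi).symm

variable [DecidableEq C]

/-- Two blocks that both avoid two disjoint blocks share at least `r` colors. -/
theorem big_of_disjoint (h : Config k r N A) {a b i j : ℕ} (hab : Disjoint (A a) (A b))
    (hai : Disjoint (A a) (A i)) (hbi : Disjoint (A b) (A i)) (haj : Disjoint (A a) (A j))
    (hbj : Disjoint (A b) (A j)) (ha : a < N := by omega) (hb : b < N := by omega)
    (hi : i < N := by omega) (hj : j < N := by omega) :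
    Big r A i j := by
  have h1 := Finset.card_union_of_disjoint hab
  have h2 := Finset.card_union_of_disjoint (s := A a ∪ A b) (t := A i ∪ A j)
    (by simp only [Finset.disjoint_union_left, Finset.disjoint_union_right]; tauto)
  have h3 := Finset.card_union_add_card_inter (A i) (A j)
  have h4 := Finset.card_le_univ (A a ∪ A b ∪ (A i ∪ A j))
  have h5 := h.card_add_le
  rw [h.card_eq a ha, h.card_eq b hb] at h1
  rw [h.card_eq i hi, h.card_eq j hj] at h3
  unfold Big
  omega

theorem exists_mem_ne (h : Config k r N A) {i j : ℕ} (hb : Big r A i j) (p : C)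
    (hi : i < N := by omega) :
    ∃ x, x ∈ A i ∧ x ∈ A j ∧ x ≠ p := by
  have h1 : 1 < (A i ∩ A j).card := by
    have h2 := Finset.card_le_card (Finset.inter_subset_left (s₁ := A i) (s₂ := A j))
    have h3 := h.le_two_mul
    rw [h.card_eq i hi] at h2
    unfold Big at hb
    omega
  obtain ⟨x, hx, hne⟩ := Finset.exists_mem_ne h1 p
  rw [Finset.mem_inter] at hx
  exact ⟨x, hx.1, hx.2, hne⟩

theorem exists_mem (h : Config k r N A) {i j : ℕ} (hb : Big r A i j) : ∃ x, x ∈ A i ∧ x ∈ A j := by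
  have h3 := h.le_two_mul
  have h1 : 0 < (A i ∩ A j).card := by
    unfold Big at hb
    omega
  obtain ⟨x, hx⟩ := Finset.card_pos.1 h1
  exact ⟨x, Finset.mem_inter.1 hx⟩

theorem not_disjoint (h : Config k r N A) {i j : ℕ} (hb : Big r A i j) :
    ¬ Disjoint (A i) (A j) := by
  obtain ⟨x, hi, hj⟩ := h.exists_mem hb
  exact fun hd => Finset.disjoint_left.1 hd hi hj

/-- The block `b` shares more than half of its colors with each of `a` and `c`, so these have common
colors inside it. -/
theorem exists_mem_ne_of_big (h : Config k r N A) {a b c : ℕ} (hab : Big r A a b)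
    (hbc : Big r A b c) (p : C) (hb : b < N := by omega) : ∃ x, x ∈ A a ∧ x ∈ A b ∧ x ∈ A c ∧ x ≠ p := by
  have h1 := Finset.card_union_add_card_inter (A a ∩ A b) (A b ∩ A c)
  have h2 : ((A a ∩ A b) ∪ (A b ∩ A c)).card ≤ k := by
    rw [← h.card_eq b hb]
    exact Finset.card_le_card (Finset.union_subset Finset.inter_subset_right
      Finset.inter_subset_left)
  have h3 := h.le_two_mul
  unfold Big at hab hbc
  have h4 : 1 < ((A a ∩ A b) ∩ (A b ∩ A c)).card := by omega
  obtain ⟨x, hx, hne⟩ := Finset.exists_mem_ne h4 p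
  simp only [Finset.mem_inter] at hx
  exact ⟨x, hx.1.1, hx.1.2, hx.2.2, hne⟩

theorem exists_mem_of_big (h : Config k r N A) {a b c : ℕ} (hab : Big r A a b)
    (hbc : Big r A b c) (hb : b < N := by omega) : ∃ x, x ∈ A a ∧ x ∈ A b ∧ x ∈ A c := by
  obtain ⟨p, -⟩ := h.exists_mem hab
  obtain ⟨x, h1, h2, h3, -⟩ := h.exists_mem_ne_of_big hab hbc p
  exact ⟨x, h1, h2, h3⟩

/-- A block cannot share more than half of its colors with each of two disjoint blocks. -/
theorem not_big_of_big (h : Config k r N A) {a b c : ℕ} (hab : Big r A a b)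
    (hbc : Big r A b c) (hac : Disjoint (A a) (A c)) (hb : b < N := by omega) : False := by
  obtain ⟨x, h1, -, h3⟩ := h.exists_mem_of_big hab hbc
  exact Finset.disjoint_left.1 hac h1 h3

end Config

end

section
variable {C : Type*} [Fintype C] {k r N : ℕ} {A : ℕ → Finset C}

namespace Config

/-! ### Colors common to blocks at distance two, three and four -/

theorem disjoint_or_disjoint (h : Config k r N A) (s : ℕ) (hs : s + 4 ≤ N := by omega) :
    Disjoint (A s) (A (s + 2)) ∨ Disjoint (A (s + 1)) (A (s + 3)) := by
  simp only [Finset.disjoint_left]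
  by_contra! hc
  obtain ⟨⟨x, x0, x2⟩, y, y1, y3⟩ := hc
  exact (h.shift s hs).false_of_triples [(0, 2, x), (1, 3, y)] (by simp) (by simp [*]) (by simp)
    (by simp)

theorem disjoint_zero_two (h : Config k r 5 A) (h03 : ¬ Disjoint (A 0) (A 3))
    (h14 : ¬ Disjoint (A 1) (A 4)) : Disjoint (A 0) (A 2) := by
  by_contra h02
  obtain ⟨x, x0, x2⟩ := Finset.not_disjoint_iff.1 h02
  obtain ⟨y, y0, y3⟩ := Finset.not_disjoint_iff.1 h03
  obtain ⟨z, z1, z4⟩ := Finset.not_disjoint_iff.1 h14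
  have xy : x ≠ y := ne_of_disjoint (h.disjoint_succ 2) x2 y3
  exact h.false_of_triples [(0, 2, x), (0, 3, y), (1, 4, z)] (by simp) (by simp [*])
    (by simp [*]) (by simp)

theorem disjoint_two_five (h : Config k r 6 A) (h03 : ¬ Disjoint (A 0) (A 3))
    (h14 : ¬ Disjoint (A 1) (A 4)) : Disjoint (A 2) (A 5) := by
  by_contra h25
  obtain ⟨x, x0, x3⟩ := Finset.not_disjoint_iff.1 h03
  obtain ⟨y, y1, y4⟩ := Finset.not_disjoint_iff.1 h14
  obtain ⟨z, z2, z5⟩ := Finset.not_disjoint_iff.1 h25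
  exact h.false_of_triples [(0, 3, x), (1, 4, y), (2, 5, z)] (by simp) (by simp [*]) (by simp)
    (by simp)

variable [DecidableEq C]

theorem disjoint_of_big (h : Config k r N A) (s : ℕ) (hb : Big r A s (s + 2))
    (hs : s + 4 ≤ N := by omega) : Disjoint (A (s + 1)) (A (s + 3)) :=
  (h.disjoint_or_disjoint s).resolve_left (h.not_disjoint hb)

theorem disjoint_of_big' (h : Config k r N A) (s : ℕ) (hb : Big r A (s + 1) (s + 3))
    (hs : s + 4 ≤ N := by omega) : Disjoint (A s) (A (s + 2)) :=
  (h.disjoint_or_disjoint s).resolve_right (h.not_disjoint hb)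

/-- Two consecutive coincidences at distance three determine the pattern of the neighboring blocks:
it is that of the word `a b c a b a c`, except that the blocks `1` and `3` may have some colors in
common. -/
theorem pair_pattern (h : Config k r 7 A) (h03 : ¬ Disjoint (A 0) (A 3))
    (h14 : ¬ Disjoint (A 1) (A 4)) :
    Disjoint (A 0) (A 2) ∧ Disjoint (A 2) (A 4) ∧ Disjoint (A 2) (A 5) ∧ Disjoint (A 1) (A 5) ∧
      Big r A 1 4 ∧ Big r A 2 6 ∧ Big r A 3 5 := by
  have d02 : Disjoint (A 0) (A 2) := (h.mono (by omega)).disjoint_zero_two h03 h14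
  have d24 : Disjoint (A 2) (A 4) :=
    ((h.mono (M := 5) (by omega)).reflect.disjoint_zero_two (fun hd => h14 hd.symm)
      (fun hd => h03 hd.symm)).symm
  have d25 : Disjoint (A 2) (A 5) := (h.mono (by omega)).disjoint_two_five h03 h14
  have b35 : Big r A 3 5 := h.big_of_disjoint d24 (h.disjoint_succ 2) (h.succ_disjoint 3) d25
    (h.disjoint_succ 4)
  have d46 : Disjoint (A 4) (A 6) := h.disjoint_of_big 3 b35
  have b26 : Big r A 2 6 := h.big_of_disjoint (h.disjoint_succ 4) d24.symm d25.symm d46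
    (h.disjoint_succ 5)
  have d15 : Disjoint (A 1) (A 5) := by
    by_contra h15
    obtain ⟨x, x0, x3⟩ := Finset.not_disjoint_iff.1 h03
    obtain ⟨y, y1, y4⟩ := Finset.not_disjoint_iff.1 h14
    obtain ⟨z, z1, z5⟩ := Finset.not_disjoint_iff.1 h15
    obtain ⟨u, u2, u6⟩ := h.exists_mem b26
    have yz : y ≠ z := ne_of_disjoint (h.disjoint_succ 4) y4 z5
    exact h.false_of_triples [(0, 3, x), (1, 4, y), (1, 5, z), (2, 6, u)] (by simp) (by simp [*])
      (by simp [*]) (by simp)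
  have b14 : Big r A 1 4 := h.big_of_disjoint d25 (h.succ_disjoint 1) d15.symm d24
    (h.succ_disjoint 4)
  exact ⟨d02, d24, d25, d15, b14, b26, b35⟩

/-- The mirror image of `pair_pattern`. -/
theorem pair_pattern' (h : Config k r 7 A) (h25 : ¬ Disjoint (A 2) (A 5))
    (h36 : ¬ Disjoint (A 3) (A 6)) :
    Disjoint (A 4) (A 6) ∧ Disjoint (A 2) (A 4) ∧ Disjoint (A 1) (A 4) ∧ Disjoint (A 1) (A 5) ∧
      Big r A 2 5 ∧ Big r A 0 4 ∧ Big r A 1 3 := by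
  obtain ⟨d1, d2, d3, d4, b1, b2, b3⟩ := h.reflect.pair_pattern (fun hd => h36 hd.symm)
    (fun hd => h25 hd.symm)
  exact ⟨d1.symm, d2.symm, d3.symm, d4.symm, b1.symm, b2.symm, b3.symm⟩

/-- The blocks before and after a strong coincidence at distance two share many colors. -/
theorem big_zero_four (h : Config k r 7 A) (h13 : Big r A 1 3) : Big r A 0 4 := by
  have d02 : Disjoint (A 0) (A 2) := h.disjoint_of_big' 0 h13
  have d24 : Disjoint (A 2) (A 4) := h.disjoint_of_big 1 h13
  by_cases h03 : Disjoint (A 0) (A 3)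
  · exact h.big_of_disjoint (h.disjoint_succ 2) d02.symm h03.symm d24 (h.disjoint_succ 3)
  by_cases h14 : Disjoint (A 1) (A 4)
  · exact h.big_of_disjoint (h.disjoint_succ 1) (h.succ_disjoint 0) d02.symm h14 d24
  obtain ⟨-, -, -, -, b14, -⟩ := h.pair_pattern h03 h14
  exact (h.not_big_of_big h13.symm b14 (h.disjoint_succ 3)).elim

theorem big_two_six (h : Config k r 7 A) (h35 : Big r A 3 5) : Big r A 2 6 :=
  Big.symm (h.reflect.big_zero_four h35.symm)

/-- Two strong coincidences at distance two are not at distance two from each other. -/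
theorem false_of_big_of_big_two (h : Config k r 7 A) (h13 : Big r A 1 3) (h35 : Big r A 3 5) :
    False := by
  obtain ⟨x, x0, x4⟩ := h.exists_mem (h.big_zero_four h13)
  obtain ⟨y, y1, y3, y5⟩ := h.exists_mem_of_big h13 h35
  obtain ⟨z, z2, z6⟩ := h.exists_mem (h.big_two_six h35)
  obtain ⟨u, u3, u5, uy⟩ := h.exists_mem_ne h35 y
  exact h.false_of_triples [(0, 4, x), (1, 5, y), (2, 6, z), (3, 5, u)] (by simp) (by simp [*])
    (by simp [*, uy.symm]) (by simp)

/-- What follows a strong coincidence at distance two: either the next one is at distance three, or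
there are two consecutive coincidences at distance three. -/
theorem big_three_five_or (h : Config k r 6 A) (h02 : Big r A 0 2)
    (hno : ¬ Big r A 2 4) :
    ¬ Disjoint (A 1) (A 4) ∧ (Big r A 3 5 ∧ Big r A 1 4 ∨ ¬ Disjoint (A 2) (A 5)) := by
  have d13 : Disjoint (A 1) (A 3) := h.disjoint_of_big 0 h02
  constructor
  · intro h14
    exact hno (h.big_of_disjoint d13 (h.disjoint_succ 1) (h.succ_disjoint 2) h14 (h.disjoint_succ 3))
  · by_cases h25 : Disjoint (A 2) (A 5)
    · left
      rcases h.disjoint_or_disjoint 2 with h24 | h35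
      · refine ⟨h.big_of_disjoint h24 (h.disjoint_succ 2) (h.succ_disjoint 3) h25
          (h.disjoint_succ 4), ?_⟩
        exact h.big_of_disjoint (h.disjoint_succ 2) (h.succ_disjoint 1) d13.symm h24
          (h.disjoint_succ 3)
      · exact absurd (h.big_of_disjoint h35 (h.succ_disjoint 2) h25.symm (h.disjoint_succ 3)
          (h.succ_disjoint 4)) hno
    · exact Or.inr h25

theorem big_two_five (h : Config k r 7 A) (h13 : Big r A 1 3) : Big r A 2 5 := by
  obtain ⟨h25, ⟨-, hb⟩ | h36⟩ := (h.shift 1 (M := 6) (by omega)).big_three_five_or h13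
    fun hb => h.false_of_big_of_big_two h13 hb
  · exact hb
  · exact (h.pair_pattern' h25 h36).2.2.2.2.1

theorem big_one_four (h : Config k r 7 A) (h35 : Big r A 3 5) : Big r A 1 4 :=
  Big.symm (h.reflect.big_two_five h35.symm)

/-- Two strong coincidences at distance two are not at distance three from each other. -/
theorem false_of_big_of_big_three (h : Config k r 12 A) (h35 : Big r A 3 5)
    (h68 : Big r A 6 8) : False := by
  have h0 : Config k r 7 A := h.mono (by omega)
  have b14 : Big r A 1 4 := h0.big_one_four h35
  have b47 : Big r A 4 7 := (h.shift 2 (M := 7) (by omega)).big_two_five h35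
  have b26 : Big r A 2 6 := h0.big_two_six h35
  have b59 : Big r A 5 9 := (h.shift 5 (M := 7) (by omega)).big_zero_four h68
  have b710 : Big r A 7 10 := (h.shift 5 (M := 7) (by omega)).big_two_five h68
  obtain ⟨x, x1, x4, x7⟩ := h.exists_mem_of_big b14 b47
  obtain ⟨y, y2, y6, y8⟩ := h.exists_mem_of_big b26 h68
  obtain ⟨z, z3, z5, z9⟩ := h.exists_mem_of_big h35 b59
  obtain ⟨u, u4, u7, u10⟩ := h.exists_mem_of_big b47 b710
  obtain ⟨v, v5, v9, vz⟩ := h.exists_mem_ne b59 z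
  obtain ⟨w, w6, w8, wy⟩ := h.exists_mem_ne h68 y
  exact h.false_of_triples
    [(1, 7, x), (2, 8, y), (3, 9, z), (4, 10, u), (5, 9, v), (6, 8, w)] (by simp) (by simp [*])
    (by simp [*, vz.symm, wy.symm]) (by simp)

/-- The step of the periodic pattern: after a strong coincidence at distance two there are two
consecutive coincidences at distance three, and the next strong coincidence at distance two starts
four blocks later. -/
theorem pair_of_big (h : Config k r 12 A) (h35 : Big r A 3 5) :
    ¬ Disjoint (A 4) (A 7) ∧ ¬ Disjoint (A 5) (A 8) ∧ Big r A 7 9 := by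
  obtain ⟨h47, ⟨hb, -⟩ | h58⟩ := (h.shift 3 (M := 6) (by omega)).big_three_five_or h35
    fun hb => (h.shift 2 (M := 7) (by omega)).false_of_big_of_big_two h35 hb
  · exact (h.false_of_big_of_big_three h35 hb).elim
  · exact ⟨h47, h58, ((h.shift 4 (M := 7) (by omega)).pair_pattern h47 h58).2.2.2.2.2.2⟩

theorem exists_big (h : Config k r 7 A) : ∃ s ≤ 3, Big r A s (s + 2) := by
  by_cases h03 : Disjoint (A 0) (A 3)
  · rcases h.disjoint_or_disjoint 0 with h02 | h13
    · exact ⟨1, by omega, h.big_of_disjoint h02 (h.disjoint_succ 0) (h.succ_disjoint 1) h03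
        (h.disjoint_succ 2)⟩
    · exact ⟨0, by omega, h.big_of_disjoint h13 (h.succ_disjoint 0) h03.symm (h.disjoint_succ 1)
        (h.succ_disjoint 2)⟩
  by_cases h14 : Disjoint (A 1) (A 4)
  · rcases h.disjoint_or_disjoint 1 with h13 | h24
    · exact ⟨2, by omega, h.big_of_disjoint h13 (h.disjoint_succ 1) (h.succ_disjoint 2) h14
        (h.disjoint_succ 3)⟩
    · exact ⟨1, by omega, h.big_of_disjoint h24 (h.succ_disjoint 1) h14.symm (h.disjoint_succ 2)
        (h.succ_disjoint 3)⟩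
  exact ⟨3, le_rfl, (h.pair_pattern h03 h14).2.2.2.2.2.2⟩


/-! ### The periodic pattern -/

/-- Let `A 4`, `A 8` and `A 5`, `A 7` be two pairs of blocks that avoid each other and `A 6`. Together
the pairs have so many common colors that two blocks avoiding these are not disjoint. -/
theorem not_disjoint_of_disjoint_inter (h : Config k r N A) {i j : ℕ}
    (d46 : Disjoint (A 4) (A 6)) (d47 : Disjoint (A 4) (A 7)) (d58 : Disjoint (A 5) (A 8))
    (d68 : Disjoint (A 6) (A 8)) (hi1 : Disjoint (A i) (A 4 ∩ A 8))
    (hi2 : Disjoint (A i) (A 5 ∩ A 7)) (hj1 : Disjoint (A j) (A 4 ∩ A 8))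
    (hj2 : Disjoint (A j) (A 5 ∩ A 7)) (hi : i < N := by omega) (hj : j < N := by omega)
    (hN : 9 ≤ N := by omega) : ¬ Disjoint (A i) (A j) := by
  intro hd
  have e1 := Finset.card_union_add_card_inter (A 4) (A 8)
  have e2 := Finset.card_union_add_card_inter (A 5) (A 7)
  have d45 := h.disjoint_succ 4
  have d87 := h.succ_disjoint 7
  have d56 := h.disjoint_succ 5
  have d76 := h.succ_disjoint 6
  have e3 := Finset.card_union_of_disjoint (s := A 4 ∪ A 8) (t := A 5 ∪ A 7)
    (by simp only [Finset.disjoint_union_left, Finset.disjoint_union_right]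
        exact ⟨⟨d45, d58.symm⟩, d47, d87⟩)
  have e4 := Finset.card_union_of_disjoint (s := (A 4 ∪ A 8) ∪ (A 5 ∪ A 7)) (t := A 6)
    (by simp only [Finset.disjoint_union_left]
        exact ⟨⟨d46, d68.symm⟩, d56, d76⟩)
  have e5 := Finset.card_le_univ ((A 4 ∪ A 8) ∪ (A 5 ∪ A 7) ∪ A 6)
  have e6 := Finset.card_union_of_disjoint hd
  have e7 := Finset.card_union_of_disjoint (s := A 4 ∩ A 8) (t := A 5 ∩ A 7)
    (d45.mono Finset.inter_subset_left Finset.inter_subset_left)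
  have e8 := Finset.card_union_of_disjoint (s := A i ∪ A j) (t := (A 4 ∩ A 8) ∪ (A 5 ∩ A 7))
    (by simp only [Finset.disjoint_union_left, Finset.disjoint_union_right]
        exact ⟨⟨hi1, hj1⟩, hi2, hj2⟩)
  have e9 := Finset.card_le_univ ((A i ∪ A j) ∪ ((A 4 ∩ A 8) ∪ (A 5 ∩ A 7)))
  have h4 := h.card_eq 4 (by omega)
  have h5 := h.card_eq 5 (by omega)
  have h6 := h.card_eq 6 (by omega)
  have h7 := h.card_eq 7 (by omega)
  have h8 := h.card_eq 8 (by omega)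
  have h9 := h.card_eq i hi
  have h10 := h.card_eq j hj
  have b1 := h.card_add_le
  have b2 := h.le_two_mul
  omega

theorem disjoint_four_ten (h : Config k r 13 A) (b36 : Big r A 3 6) (b69 : Big r A 6 9)
    (b57 : Big r A 5 7) (b710 : Big r A 7 10) (b48 : Big r A 4 8) : Disjoint (A 4) (A 10) := by
  by_contra hc
  obtain ⟨x, x4, x10⟩ := Finset.not_disjoint_iff.1 hc
  obtain ⟨y, y3, y6, y9⟩ := h.exists_mem_of_big b36 b69
  obtain ⟨z, z5, z7, z10⟩ := h.exists_mem_of_big b57 b710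
  obtain ⟨u, u4, u8, ux⟩ := h.exists_mem_ne b48 x
  obtain ⟨v, v5, v7, vz⟩ := h.exists_mem_ne b57 z
  obtain ⟨w, w6, w9, wy⟩ := h.exists_mem_ne b69 y
  have xz : x ≠ z := ne_of_disjoint (h.disjoint_succ 4) x4 z5
  exact h.false_of_triples
    [(5, 7, v), (4, 8, u), (3, 9, y), (4, 10, x), (5, 10, z), (6, 9, w)] (by simp) (by simp [*])
    (by simp [*, wy.symm, ux.symm]) (by simp)

/-- If pairs of coincidences at distance three occur four blocks apart, then the blocks `i` and
`i + 8` have a common color for `i = 1` and `i = 3`, and also for `i = 2` unless the blocks `2`, `9`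
and `3`, `10` have, which serves the same purpose. -/
theorem period_eight (h : Config k r 13 A) (h25 : ¬ Disjoint (A 2) (A 5))
    (h36 : ¬ Disjoint (A 3) (A 6)) (h69 : ¬ Disjoint (A 6) (A 9))
    (h710 : ¬ Disjoint (A 7) (A 10)) :
    ¬ Disjoint (A 1) (A 9) ∧ ¬ Disjoint (A 3) (A 11) ∧ Big r A 4 8 ∧
      (¬ Disjoint (A 2) (A 10) ∨ ¬ Disjoint (A 2) (A 9) ∧ ¬ Disjoint (A 3) (A 10)) := by
  obtain ⟨d46, d24, d14, d15, b25, b04, b13⟩ :=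
    (h.mono (M := 7) (by omega)).pair_pattern' h25 h36
  obtain ⟨-, -, d47, d37, b36, b48, b57⟩ :
      Disjoint (A 2) (A 4) ∧ Disjoint (A 4) (A 6) ∧ Disjoint (A 4) (A 7) ∧ Disjoint (A 3) (A 7) ∧
        Big r A 3 6 ∧ Big r A 4 8 ∧ Big r A 5 7 :=
    (h.shift 2 (M := 7) (by omega)).pair_pattern h25 h36
  obtain ⟨d810, d68, d58, d59, b69, -, -⟩ :
      Disjoint (A 8) (A 10) ∧ Disjoint (A 6) (A 8) ∧ Disjoint (A 5) (A 8) ∧ Disjoint (A 5) (A 9) ∧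
        Big r A 6 9 ∧ Big r A 4 8 ∧ Big r A 5 7 :=
    (h.shift 4 (M := 7) (by omega)).pair_pattern' h69 h710
  obtain ⟨-, -, d811, d711, b710, -, b911⟩ :
      Disjoint (A 6) (A 8) ∧ Disjoint (A 8) (A 10) ∧ Disjoint (A 8) (A 11) ∧
        Disjoint (A 7) (A 11) ∧ Big r A 7 10 ∧ Big r A 8 12 ∧ Big r A 9 11 :=
    (h.shift 6 (M := 7) (by omega)).pair_pattern h69 h710
  refine ⟨?_, ?_, b48, ?_⟩
  · exact h.not_disjoint_of_disjoint_inter d46 d47 d58 d68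
      (d14.mono_right Finset.inter_subset_left) (d15.mono_right Finset.inter_subset_left)
      ((h.succ_disjoint 8).mono_right Finset.inter_subset_right)
      (d59.symm.mono_right Finset.inter_subset_left)
  · exact h.not_disjoint_of_disjoint_inter d46 d47 d58 d68
      ((h.disjoint_succ 3).mono_right Finset.inter_subset_left)
      (d37.mono_right Finset.inter_subset_right) (d811.symm.mono_right Finset.inter_subset_right)
      (d711.symm.mono_right Finset.inter_subset_right)
  · by_cases h210 : Disjoint (A 2) (A 10)
    · right
      have d410 : Disjoint (A 4) (A 10) := h.disjoint_four_ten b36 b69 b57 b710 b48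
      have d28 : Disjoint (A 8) (A 2) :=
        h.reflect.disjoint_four_ten b69.symm b36.symm b57.symm b25.symm b48.symm
      constructor
      · exact h.not_disjoint (h.big_of_disjoint d810 d28 h210.symm (h.disjoint_succ 8)
          (h.succ_disjoint 9))
      · exact h.not_disjoint (h.big_of_disjoint d24 (h.disjoint_succ 2) (h.succ_disjoint 3) h210
          d410)
    · exact Or.inl h210

/-- The pattern of period eight does not last for two periods. -/
theorem false_of_pairs (h : Config k r 17 A) (h25 : ¬ Disjoint (A 2) (A 5))
    (h36 : ¬ Disjoint (A 3) (A 6)) (h69 : ¬ Disjoint (A 6) (A 9)) (h710 : ¬ Disjoint (A 7) (A 10))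
    (h1013 : ¬ Disjoint (A 10) (A 13)) (h1114 : ¬ Disjoint (A 11) (A 14)) : False := by
  obtain ⟨n19, n311, b48, n210⟩ := (h.mono (M := 13) (by omega)).period_eight h25 h36 h69 h710
  obtain ⟨n513, n715, b812, n614⟩ :
      ¬ Disjoint (A 5) (A 13) ∧ ¬ Disjoint (A 7) (A 15) ∧ Big r A 8 12 ∧
        (¬ Disjoint (A 6) (A 14) ∨ ¬ Disjoint (A 6) (A 13) ∧ ¬ Disjoint (A 7) (A 14)) :=
    (h.shift 4 (M := 13) (by omega)).period_eight h69 h710 h1013 h1114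
  have b1216 : Big r A 12 16 :=
    ((h.shift 10 (M := 7) (by omega)).pair_pattern h1013 h1114).2.2.2.2.2.1
  obtain ⟨a, a1, a9⟩ := Finset.not_disjoint_iff.1 n19
  obtain ⟨c, c3, c11⟩ := Finset.not_disjoint_iff.1 n311
  obtain ⟨d, d4, d8, d12⟩ := h.exists_mem_of_big b48 b812
  obtain ⟨e, e5, e13⟩ := Finset.not_disjoint_iff.1 n513
  obtain ⟨g, g7, g15⟩ := Finset.not_disjoint_iff.1 n715
  obtain ⟨w, w8, w12, w16⟩ := h.exists_mem_of_big b812 b1216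
  rcases n210 with n210 | ⟨n29, n310⟩
  · obtain ⟨b, b2, b10⟩ := Finset.not_disjoint_iff.1 n210
    rcases n614 with n614 | ⟨n613, n714⟩
    · obtain ⟨f, f6, f14⟩ := Finset.not_disjoint_iff.1 n614
      exact h.false_of_triples
        [(1, 9, a), (2, 10, b), (3, 11, c), (4, 12, d), (5, 13, e),
          (6, 14, f), (7, 15, g), (8, 16, w)] (by simp) (by simp [*]) (by simp [*]) (by simp)
    · obtain ⟨f, f6, f13⟩ := Finset.not_disjoint_iff.1 n613
      obtain ⟨f', f7, f14⟩ := Finset.not_disjoint_iff.1 n714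
      have ef : e ≠ f := ne_of_disjoint (h.disjoint_succ 5) e5 f6
      have fg : f' ≠ g := ne_of_disjoint (h.disjoint_succ 14) f14 g15
      exact h.false_of_triples
        [(1, 9, a), (2, 10, b), (3, 11, c), (4, 12, d), (5, 13, e),
          (6, 13, f), (7, 14, f'), (7, 15, g), (8, 16, w)] (by simp) (by simp [*]) (by simp [*]) (by simp)
  · obtain ⟨b, b2, b9⟩ := Finset.not_disjoint_iff.1 n29
    obtain ⟨b', b3, b10⟩ := Finset.not_disjoint_iff.1 n310
    have ab : a ≠ b := ne_of_disjoint (h.disjoint_succ 1) a1 b2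
    have bc : b' ≠ c := ne_of_disjoint (h.disjoint_succ 10) b10 c11
    rcases n614 with n614 | ⟨n613, n714⟩
    · obtain ⟨f, f6, f14⟩ := Finset.not_disjoint_iff.1 n614
      exact h.false_of_triples
        [(1, 9, a), (2, 9, b), (3, 10, b'), (3, 11, c), (4, 12, d),
          (5, 13, e), (6, 14, f), (7, 15, g), (8, 16, w)] (by simp) (by simp [*]) (by simp [*]) (by simp)
    · obtain ⟨f, f6, f13⟩ := Finset.not_disjoint_iff.1 n613
      obtain ⟨f', f7, f14⟩ := Finset.not_disjoint_iff.1 n714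
      have ef : e ≠ f := ne_of_disjoint (h.disjoint_succ 5) e5 f6
      have fg : f' ≠ g := ne_of_disjoint (h.disjoint_succ 14) f14 g15
      exact h.false_of_triples
        [(1, 9, a), (2, 9, b), (3, 10, b'), (3, 11, c), (4, 12, d),
          (5, 13, e), (6, 13, f), (7, 14, f'), (7, 15, g), (8, 16, w)] (by simp) (by simp [*]) (by simp [*]) (by simp)

theorem false_of_twenty_three (h : Config k r 23 A) : False := by
  obtain ⟨s, hs, hb⟩ := (h.shift 3 (M := 7) (by omega)).exists_big
  have h' := h.shift s (M := 20) (by omega)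
  have b35 : Big r (fun i => A (s + i)) 3 5 := by
    simp only [Big] at hb ⊢
    rwa [show s + 3 = 3 + s by omega, show s + 5 = 3 + (s + 2) by omega]
  obtain ⟨h47, h58, b79⟩ := (h'.mono (M := 12) (by omega)).pair_of_big b35
  obtain ⟨h811, h912, b1113⟩ := (h'.shift 4 (M := 12) (by omega)).pair_of_big b79
  obtain ⟨h1215, h1316, -⟩ := (h'.shift 8 (M := 12) (by omega)).pair_of_big b1113
  exact (h'.shift 2 (M := 17) (by omega)).false_of_pairs h47 h58 h811 h912 h1215 h1316

end Config

end

/-! ### The lower bound -/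

/-- The color sets of the copies of the complete graph form a configuration. -/
theorem config_of_isNonrepetitive {n k m r : ℕ} {c : Fin n × Fin k → Fin m}
    (hc : IsNonrepetitive (lexProduct (SimpleGraph.pathGraph n) (⊤ : SimpleGraph (Fin k))) c)
    (hm : m + r ≤ 4 * k) (hr : k + 2 ≤ 2 * r) :
    Config k r n (fun i => {x | ∃ q : Fin n × Fin k, (q.1 : ℕ) = i ∧ c q = x}) where
  card_eq i hi := by
    have hset : ({x | ∃ q : Fin n × Fin k, (q.1 : ℕ) = i ∧ c q = x} : Finset (Fin m)) =
        Finset.univ.image fun t : Fin k => c (⟨i, hi⟩, t) := by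
      ext x
      simp only [Finset.mem_filter, Finset.mem_univ, true_and, Finset.mem_image]
      constructor
      · rintro ⟨⟨j, t⟩, rfl, h⟩
        exact ⟨t, h⟩
      · rintro ⟨t, h⟩
        exact ⟨(⟨i, hi⟩, t), rfl, h⟩
    rw [hset, Finset.card_image_of_injective, Finset.card_univ, Fintype.card_fin]
    -- Two vertices of the same color in the same block would form a repetition.
    intro s t hst
    by_contra hne
    have hadj : (lexProduct (SimpleGraph.pathGraph n) (⊤ : SimpleGraph (Fin k))).Adj
        (⟨i, hi⟩, s) (⟨i, hi⟩, t) := Or.inr ⟨rfl, hne⟩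
    exact hc _ _ hadj.toWalk (SimpleGraph.Walk.IsPath.of_adj hadj)
      ⟨[c (⟨i, hi⟩, s)], by simp, by simpa using hst.symm⟩
  card_add_le := by simpa using hm
  le_two_mul := hr
  not_repetition l₁ l₂ h0 h1 h2 h3 h4 := by
    have hex : ∀ v ∈ l₁ ++ l₂, ∃ q : Fin n × Fin k, (q.1 : ℕ) = v.1 ∧ c q = v.2 := fun v hv => by
      simpa using (h2 v hv).2
    obtain ⟨v₀, hv₀⟩ := List.exists_mem_of_ne_nil _ h0
    obtain ⟨q₀, -⟩ := hex v₀ (List.mem_append_left _ hv₀)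
    obtain ⟨g, hg⟩ : ∃ g : ℕ × Fin m → Fin n × Fin k, ∀ v ∈ l₁ ++ l₂,
        ((g v).1 : ℕ) = v.1 ∧ c (g v) = v.2 := by
      have : ∀ v : ℕ × Fin m, ∃ q : Fin n × Fin k, v ∈ l₁ ++ l₂ → (q.1 : ℕ) = v.1 ∧ c q = v.2 :=
        fun v => by
          by_cases hv : v ∈ l₁ ++ l₂
          · obtain ⟨q, hq⟩ := hex v hv
            exact ⟨q, fun _ => hq⟩
          · exact ⟨q₀, fun hv' => absurd hv' hv⟩
      choose g hg using this
      exact ⟨g, hg⟩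
    have hinj : ∀ v ∈ l₁ ++ l₂, ∀ w ∈ l₁ ++ l₂, g v = g w → v = w := fun v hv w hw he =>
      Prod.ext (by rw [← (hg v hv).1, ← (hg w hw).1, he]) (by rw [← (hg v hv).2, ← (hg w hw).2, he])
    have hne : (l₁ ++ l₂).map g ≠ [] := by simpa using fun h => absurd h h0
    have hnodup : ((l₁ ++ l₂).map g).Nodup := h3.map_on hinj
    have hchain : ((l₁ ++ l₂).map g).IsChain
        (lexProduct (SimpleGraph.pathGraph n) (⊤ : SimpleGraph (Fin k))).Adj := by
      rw [List.isChain_iff_getElem]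
      intro i hi
      have hd : ((l₁ ++ l₂).map g)[i] ≠ ((l₁ ++ l₂).map g)[i + 1] := fun h => by
        have := (hnodup.getElem_inj_iff).1 h
        omega
      simp only [List.length_map] at hi
      simp only [List.getElem_map] at hd ⊢
      have h5 := List.isChain_iff_getElem.1 h4 i hi
      rw [← (hg _ (List.getElem_mem _)).1, ← (hg _ (List.getElem_mem _)).1] at h5
      generalize g (l₁ ++ l₂)[i] = p at hd h5 ⊢
      generalize g (l₁ ++ l₂)[i + 1] = q at hd h5 ⊢
      by_cases hpq : p.1 = q.1
      · exact Or.inr ⟨hpq, fun h => hd (Prod.ext hpq h)⟩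
      · left
        rw [SimpleGraph.pathGraph_adj]
        have : (p.1 : ℕ) ≠ q.1 := fun h => hpq (Fin.ext h)
        omega
    have hcol : ∀ l : List (ℕ × Fin m), (∀ v ∈ l, v ∈ l₁ ++ l₂) →
        (l.map g).map c = l.map Prod.snd := fun l hl => by
      rw [List.map_map]
      exact List.map_congr_left fun v hv => (hg v (hl v hv)).2
    refine hc _ _ (SimpleGraph.Walk.ofSupport _ hne hchain)
      (SimpleGraph.Walk.IsPath.mk' (by rwa [SimpleGraph.Walk.support_ofSupport]))
      ⟨l₁.map Prod.snd, by simpa using h0, ?_⟩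
    rw [SimpleGraph.Walk.support_ofSupport, List.map_append, List.map_append,
      hcol l₁ fun v => List.mem_append_left _, hcol l₂ fun v => List.mem_append_right _, h1]

end ThueLex

theorem theorem3 (n k : ℕ) (hn : 28 ≤ n) (hk : 1 ≤ k) :
    ((3 * k + k / 2 : ℕ) : ℕ∞) ≤
        ThueLex.thueNumber
          (ThueLex.lexProduct (SimpleGraph.pathGraph n) (⊤ : SimpleGraph (Fin k))) ∧
      ThueLex.thueNumber
          (ThueLex.lexProduct (SimpleGraph.pathGraph n) (⊤ : SimpleGraph (Fin k))) ≤
        ((4 * k : ℕ) : ℕ∞) := by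
  constructor
  · refine le_iInf₂ fun m hm => ?_
    obtain ⟨c, hc⟩ := hm
    by_contra hlt
    have hlt' : m < 3 * k + k / 2 := by simpa only [not_le, Nat.cast_lt] using hlt
    have hconf := ThueLex.config_of_isNonrepetitive (r := k - k / 2 + 1) hc (by omega) (by omega)
    exact (hconf.mono (by omega)).false_of_twenty_three
  · exact iInf₂_le _ ⟨_, ThueLex.isNonrepetitive_quaternaryWord n k⟩
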